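/- Let $\mathbb M=(M,<,\dots)$ be an o-minimal structure (every subset of $M$ definable with parameters is a finite union of points and open intervals with endpoints in $M\cup\{\pm\infty\}$), and let $\mathbb P\preceq\mathbb M$, with domain $P$, be a prime model over $\emptyset$ of its theory. Say that $\mathbb M$ has definable Skolem functions if for every family $\{X_t\}_{t\in T}$ of nonempty subsets of some $M^k$ that is uniformly definable with parameters there is a function $h:T\to M^k$, definable with parameters, such that $h(t)\in X_t$ for all $t\in T$. For a set $A$ let $\mathrm{dcl}(A)$ be the set of elements $u$ such that $\{u\}$ is definable over $A$. Call an elementary extension of $\mathbb M$ (possibly $\mathbb M$ itself) sufficiently saturated if it is $\kappa$-saturated for some cardinal $\kappa>|P|$. Then: 1. If $\mathbb M$ has definable Skolem functions, then $\mathrm{dcl}(C\cup P)\preceq\mathbb M$ for every $C\subseteq M$. 2. If $\mathbb M$ is sufficiently saturated, then $\mathbb M$ has definable Skolem functions if and only if $\mathrm{dcl}(C\cup P)\preceq\mathbb M$ for every $C\subseteq M$. 3. For arbitrary $\mathbb M$ and every sufficiently saturated elementary extension $\mathbb N\succeq\mathbb M$, with domain $N$, the structure $\mathbb M$ has definable Skolem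 functions if and only if $\mathrm{dcl}(C\cup P)\preceq\mathbb N$ for every $C\subseteq N$, where $\mathrm{dcl}$ is computed in $\mathbb N$. -/

import Mathlib

open FirstOrder Cardinal

universe u v w w'

namespace OMin

/-- Points and open intervals of a linear order, the endpoints of the intervals lying in `M ∪ {±∞}`. -/
def IsPointOrInterval {M : Type w} [LinearOrder M] (I : Set M) : Prop :=
  (∃ a, I = {a}) ∨ (∃ a b, I = Set.Ioo a b) ∨ (∃ a, I = Set.Ioi a) ∨ (∃ b, I = Set.Iio b) ∨
    I = Set.univ

/-- A linearly ordered structure is o-minimal if every subset of its domain that is definable with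
parameters is a finite union of points and open intervals. -/
def IsOMinimal (L : FirstOrder.Language.{u, v}) (M : Type w) [LinearOrder M] [L.Structure M] : Prop :=
  ∀ S : Set M, (Set.univ : Set M).Definable₁ L S →
    ∃ F : Set (Set M), F.Finite ∧ (∀ I ∈ F, IsPointOrInterval I) ∧ S = ⋃₀ F

/-- Every family `(X t)_{t ∈ T}` of nonempty subsets of `M ^ k` that is uniformly definable with
parameters has a section `h : T → M ^ k` that is definable with parameters. -/
def HasDefinableSkolemFunctions (L : FirstOrder.Language.{u, v}) (M : Type w) [L.Structure M] : Prop :=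
  ∀ (n k : ℕ) (T : Set (Fin n → M)) (X : (Fin n → M) → Set (Fin k → M)),
    (Set.univ : Set M).Definable L T →
    (Set.univ : Set M).Definable L
      {x : Fin n ⊕ Fin k → M | x ∘ Sum.inl ∈ T ∧ x ∘ Sum.inr ∈ X (x ∘ Sum.inl)} →
    (∀ t ∈ T, (X t).Nonempty) →
    ∃ h : T → (Fin k → M),
      (Set.univ : Set M).Definable L
        {x : Fin n ⊕ Fin k → M | ∃ ht : x ∘ Sum.inl ∈ T, h ⟨x ∘ Sum.inl, ht⟩ = x ∘ Sum.inr} ∧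
      ∀ t : T, h t ∈ X t

/-- The definable closure of a set of parameters. -/
def dcl (L : FirstOrder.Language.{u, v}) {M : Type w} [L.Structure M] (A : Set M) : Set M :=
  {a | A.Definable₁ L {a}}

/-- The set `A` is the domain of an elementary substructure of `M`. -/
def IsElementarySubset (L : FirstOrder.Language.{u, v}) {M : Type w} [L.Structure M] (A : Set M) : Prop :=
  ∃ S : L.ElementarySubstructure M, (S : Set M) = A

/-- `P` is a prime model (over the empty set) of its complete theory: it embeds elementarily into
every model of that theory. By the downward Löwenheim–Skolem theorem, models in
`Type (max u v w)` decide this for models in all universes. -/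
def IsPrimeModel (L : FirstOrder.Language.{u, v}) (P : Type w) [L.Structure P] : Prop :=
  ∀ (N : Type (max u v w)) [L.Structure N], N ⊨ L.completeTheory P → Nonempty (P ↪ₑ[L] N)

/-- `κ`-saturation: over fewer than `κ` parameters, every set of formulas in finitely many
variables that is finitely satisfiable in `M` is realized in `M`. -/
def IsSaturated (L : FirstOrder.Language.{u, v}) (M : Type w) [L.Structure M] (κ : Cardinal.{w}) : Prop :=
  ∀ A : Set M, #A < κ → ∀ (n : ℕ) (p : Set (L[[A]].Formula (Fin n))),
    (∀ q : Set (L[[A]].Formula (Fin n)), q ⊆ p → q.Finite →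
      ∃ x : Fin n → M, ∀ φ ∈ q, φ.Realize x) →
    ∃ x : Fin n → M, ∀ φ ∈ p, φ.Realize x

/-- `M` is `κ`-saturated for some cardinal `κ` greater than the cardinality of `P`. -/
def IsSufficientlySaturated (L : FirstOrder.Language.{u, v}) {M : Type w} [L.Structure M] (P : Set M) : Prop :=
  ∃ κ : Cardinal.{w}, #P < κ ∧ IsSaturated L M κ

end OMin

/-! Any parameters of a family can be absorbed into its index, so definable Skolem functions amount
to selectors for parameter-free families (`hasDefinableSkolemFunctions_iff`). That a given formula
yields a selector for some choice of parameters is a first-order sentence, so the property transfers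
along elementary embeddings and the parameters can be taken in P. Given selectors over P, a nonempty
set definable over dcl(C ∪ P) is a fibre of a parameter-free family and the selector picks a point
of it in dcl(C ∪ P); Tarski–Vaught finishes.

Conversely, suppose some family over W has no selector over P. Finitely many partial selectors glue,
so by saturation some t in W lies outside the domain of success of every selector over P. But dcl(t
∪ P) is elementary, hence contains a point of the fibre over t, and its definition over t ∪ P is a
selector that succeeds at t. -/

namespace OMin

open FirstOrder.Language Set

/-! ### Parameters and definable closure -/

section Definability

variable {L : FirstOrder.Language.{u, v}} {K : Type w} [L.Structure K] {α β : Type} {A B : Set K}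

/-- A set definable over `A` is defined by a formula with a finite tuple of parameters in `A`. -/
theorem definable_iff_exists_tuple {S : Set (α → K)} :
    A.Definable L S ↔ ∃ (m : ℕ) (p : Fin m → K), (∀ i, p i ∈ A) ∧
      ∃ φ : L.Formula (Fin m ⊕ α), S = {v | φ.Realize (Sum.elim p v)} := by
  constructor
  · rw [definable_iff_finitely_definable]
    rintro ⟨A₀, hA₀, hS⟩
    obtain ⟨φ, rfl⟩ := definable_iff_exists_formula_sum.1 hS
    let e : (↑A₀ : Set K) ≃ Fin A₀.card := A₀.equivFin
    refine ⟨A₀.card, fun i => (e.symm i : K), fun i => hA₀ (e.symm i).2,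
      φ.relabel (Sum.map e id), ?_⟩
    ext v
    simp only [mem_ofPred_eq, Formula.realize_relabel]
    refine iff_of_eq (congrArg _ (funext ?_))
    rintro (a | a) <;> simp
  · rintro ⟨m, p, hp, φ, rfl⟩
    refine definable_iff_exists_formula_sum.2
      ⟨φ.relabel (Sum.map (fun i => ⟨p i, hp i⟩) id), ?_⟩
    ext v
    simp only [mem_ofPred_eq, Formula.realize_relabel]
    refine iff_of_eq (congrArg _ (funext ?_))
    rintro (a | a) <;> simp

theorem definable_setOf_realize (φ : L.Formula α) : A.Definable L {v : α → K | φ.Realize v} :=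
  (empty_definable_iff.2 ⟨φ, rfl⟩).mono (empty_subset A)

theorem subset_dcl : A ⊆ dcl L A := fun _ ha => Definable.singleton_of_mem L ha

/-- Parameters in the definable closure of `A` can be replaced by parameters in `A`. -/
theorem definable_of_definable_dcl {S : Set (α → K)} (hS : (dcl L A).Definable L S) :
    A.Definable L S := by
  obtain ⟨m, p, hp, φ, rfl⟩ := definable_iff_exists_tuple.1 hS
  have hφ : A.Definable L {w : α ⊕ Fin m → K | φ.Realize (w ∘ Sum.swap)} :=
    (definable_setOf_realize φ).preimage_comp Sum.swap
  -- The parameters become variables, each pinned to its value by a formula over `A`, and are then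
  -- quantified away.
  have hpar : A.Definable L (⋂ i, {w : α ⊕ Fin m → K | w (Sum.inr i) = p i}) :=
    definable_iInter_of_finite fun i =>
      Definable.preimage_comp (fun _ : Fin 1 => (Sum.inr i : α ⊕ Fin m)) (hp i)
  convert (hφ.inter hpar).exists_of_finite using 1
  have hswap : ∀ (v : α → K) (u : Fin m → K), Sum.elim v u ∘ Sum.swap = Sum.elim u v := by
    intro v u
    funext x
    cases x <;> rfl
  ext v
  simp only [mem_ofPred_eq, mem_inter_iff, mem_iInter, Sum.elim_inr, hswap]
  constructor
  · exact fun h => ⟨p, h, fun _ => rfl⟩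
  · rintro ⟨u, hu, hup⟩
    rwa [funext hup] at hu

/-- A tuple of parameters can be turned into variables. -/
theorem exists_definable_family_of_definable {S : Set (α → K)} {t : β → K}
    (hS : (range t ∪ A).Definable L S) :
    ∃ Ψ : Set (β ⊕ α → K), A.Definable L Ψ ∧ ∀ v, Sum.elim t v ∈ Ψ ↔ v ∈ S := by
  obtain ⟨φ, rfl⟩ := definable_iff_exists_formula_sum.1 hS
  have hc : ∀ c : ↥(range t ∪ A), ∃ s : A ⊕ (β ⊕ α),
      ∀ v : α → K, Sum.elim (↑) (Sum.elim t v) s = (c : K) := by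
    rintro ⟨c, ⟨b, rfl⟩ | hc⟩
    · exact ⟨Sum.inr (Sum.inl b), fun _ => rfl⟩
    · exact ⟨Sum.inl ⟨c, hc⟩, fun _ => rfl⟩
  choose s hs using hc
  refine ⟨_, definable_iff_exists_formula_sum.2
    ⟨φ.relabel (Sum.elim s (Sum.inr ∘ Sum.inr)), rfl⟩, fun v => ?_⟩
  simp only [mem_ofPred_eq, Formula.realize_relabel]
  refine iff_of_eq (congrArg _ (funext ?_))
  rintro (a | a)
  · exact hs a v
  · rfl

end Definability

/-! ### Selectors and Skolem functions -/

section Selectors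

variable {L : FirstOrder.Language.{u, v}} {K : Type w} [L.Structure K] {α β : Type} {A B : Set K}

/-- The fibre of `Ψ` over `t` is a single point, and it lies in the fibre of `Φ`. -/
def SelectsAt (Φ Ψ : Set (α ⊕ β → K)) (t : α → K) : Prop :=
  (∃! y : β → K, Sum.elim t y ∈ Ψ) ∧ ∀ y : β → K, Sum.elim t y ∈ Ψ → Sum.elim t y ∈ Φ

/-- The formula expressing that the fibre of `ψ` is a single point of the fibre of `φ`. -/
noncomputable def selectsFormula [Finite β] (φ ψ : L.Formula (α ⊕ β)) : L.Formula α :=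
  ψ.iExsUnique β ⊓ (ψ.imp φ).iAlls β

theorem realize_selectsFormula [Finite β] (φ ψ : L.Formula (α ⊕ β)) (t : α → K) :
    (selectsFormula φ ψ).Realize t ↔
      SelectsAt {v : α ⊕ β → K | φ.Realize v} {v | ψ.Realize v} t := by
  rw [selectsFormula, Formula.realize_inf, Formula.realize_iExsUnique, Formula.realize_iAlls]
  simp only [Formula.realize_imp]
  rfl

theorem definable_setOf_selectsAt [Finite β] {Φ Ψ : Set (α ⊕ β → K)} (hΦ : A.Definable L Φ)
    (hΨ : A.Definable L Ψ) : A.Definable L {t | SelectsAt Φ Ψ t} := by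
  obtain ⟨φ, rfl⟩ := hΦ
  obtain ⟨ψ, rfl⟩ := hΨ
  refine ⟨selectsFormula φ ψ, ?_⟩
  ext t
  exact (realize_selectsFormula φ ψ t).symm

/-- Over `W`, the family `Φ` has a section definable with parameters in `A`. -/
def HasSelectorOn (L : FirstOrder.Language.{u, v}) [L.Structure K] (A : Set K)
    (Φ : Set (α ⊕ β → K)) (W : Set (α → K)) : Prop :=
  ∃ Ψ : Set (α ⊕ β → K), A.Definable L Ψ ∧ ∀ t ∈ W, SelectsAt Φ Ψ t

theorem HasSelectorOn.mono {Φ : Set (α ⊕ β → K)} {V W : Set (α → K)}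
    (hW : HasSelectorOn L A Φ W) (hVW : V ⊆ W) : HasSelectorOn L A Φ V :=
  let ⟨Ψ, hΨ, h⟩ := hW
  ⟨Ψ, hΨ, fun t ht => h t (hVW ht)⟩

theorem hasSelectorOn_empty (Φ : Set (α ⊕ β → K)) : HasSelectorOn L A Φ ∅ :=
  ⟨∅, definable_empty, fun _ ht => ht.elim⟩

/-- The set where the first selector succeeds is itself definable over `A`: use the first selector
there and the second elsewhere. -/
theorem HasSelectorOn.union [Finite β] {Φ : Set (α ⊕ β → K)} (hΦ : A.Definable L Φ)
    {V W : Set (α → K)} (hV : HasSelectorOn L A Φ V) (hW : HasSelectorOn L A Φ W) :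
    HasSelectorOn L A Φ (V ∪ W) := by
  obtain ⟨Ψ₁, hΨ₁, h₁⟩ := hV
  obtain ⟨Ψ₂, hΨ₂, h₂⟩ := hW
  have hD : A.Definable L {v : α ⊕ β → K | SelectsAt Φ Ψ₁ (v ∘ Sum.inl)} :=
    (definable_setOf_selectsAt hΦ hΨ₁).preimage_comp Sum.inl
  refine ⟨_, (hΨ₁.inter hD).union (hΨ₂.inter hD.compl), fun t ht => ?_⟩
  by_cases hs : SelectsAt Φ Ψ₁ t
  · have hmem : ∀ y : β → K, Sum.elim t y ∈ Ψ₁ ∩ {v | SelectsAt Φ Ψ₁ (v ∘ Sum.inl)} ∪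
        Ψ₂ ∩ {v | SelectsAt Φ Ψ₁ (v ∘ Sum.inl)}ᶜ ↔ Sum.elim t y ∈ Ψ₁ := fun y => by simp [hs]
    rw [SelectsAt]
    simp only [hmem]
    exact hs
  · have hmem : ∀ y : β → K, Sum.elim t y ∈ Ψ₁ ∩ {v | SelectsAt Φ Ψ₁ (v ∘ Sum.inl)} ∪
        Ψ₂ ∩ {v | SelectsAt Φ Ψ₁ (v ∘ Sum.inl)}ᶜ ↔ Sum.elim t y ∈ Ψ₂ := fun y => by simp [hs]
    rw [SelectsAt]
    simp only [hmem]
    exact h₂ t (ht.resolve_left fun h => hs (h₁ t h))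

theorem HasSelectorOn.biUnion [Finite β] {ι : Type*} {Φ : Set (α ⊕ β → K)}
    (hΦ : A.Definable L Φ) {q : Set ι} (hq : q.Finite) {W : ι → Set (α → K)}
    (hW : ∀ i ∈ q, HasSelectorOn L A Φ (W i)) : HasSelectorOn L A Φ (⋃ i ∈ q, W i) := by
  induction q, hq using Set.Finite.induction_on with
  | empty => simpa using hasSelectorOn_empty Φ
  | insert _ _ ih =>
    rw [biUnion_insert]
    exact (hW _ (mem_insert _ _)).union hΦ (ih fun i hi => hW i (mem_insert_of_mem _ hi))

/-- Every family that is definable without parameters has a section that is definable with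
parameters in `A`. -/
def HasSelectorsOver (L : FirstOrder.Language.{u, v}) [L.Structure K] (A : Set K) : Prop :=
  ∀ (n k : ℕ) (φ : L.Formula (Fin n ⊕ Fin k)),
    HasSelectorOn L A {v : Fin n ⊕ Fin k → K | φ.Realize v}
      {t | ∃ x : Fin k → K, φ.Realize (Sum.elim t x)}

theorem HasSelectorsOver.mono (hA : HasSelectorsOver L A) (hAB : A ⊆ B) :
    HasSelectorsOver L B := fun n k φ =>
  let ⟨Ψ, hΨ, h⟩ := hA n k φ
  ⟨Ψ, hΨ.mono hAB, h⟩

theorem HasSelectorsOver.exists_selector (hA : HasSelectorsOver L A) {m n k : ℕ}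
    (φ : L.Formula ((Fin m ⊕ Fin n) ⊕ Fin k)) :
    HasSelectorOn L A {v : (Fin m ⊕ Fin n) ⊕ Fin k → K | φ.Realize v}
      {t | ∃ x : Fin k → K, φ.Realize (Sum.elim t x)} := by
  obtain ⟨Ψ, hΨ, h⟩ := hA (m + n) k (φ.relabel (Sum.map finSumFinEquiv id))
  refine ⟨_, hΨ.preimage_comp (Sum.map finSumFinEquiv.symm id), fun t ht => ?_⟩
  have h₁ : ∀ y : Fin k → K, Sum.elim (t ∘ finSumFinEquiv.symm) y ∘ Sum.map finSumFinEquiv id =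
      Sum.elim t y := by
    intro y
    funext x
    cases x <;> simp
  have h₂ : ∀ y : Fin k → K, Sum.elim t y ∘ Sum.map finSumFinEquiv.symm id =
      Sum.elim (t ∘ finSumFinEquiv.symm) y := by
    intro y
    funext x
    cases x <;> simp
  have := h (t ∘ finSumFinEquiv.symm) (by simpa [h₁] using ht)
  simpa only [SelectsAt, mem_ofPred_eq, mem_preimage, Formula.realize_relabel, h₁, h₂] using this

theorem hasSelectorsOver_univ_of_hasDefinableSkolemFunctions
    (h : HasDefinableSkolemFunctions L K) : HasSelectorsOver L (univ : Set K) := by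
  intro n k φ
  obtain ⟨f, hf, hfX⟩ := h n k {t | ∃ x : Fin k → K, φ.Realize (Sum.elim t x)}
    (fun t => {x | φ.Realize (Sum.elim t x)})
    (definable_setOf_realize φ).exists_of_finite (by
      convert definable_setOf_realize (A := univ) φ using 1
      ext v
      simp only [mem_ofPred_eq, Sum.elim_comp_inl_inr, and_iff_right_iff_imp]
      exact fun hv => ⟨v ∘ Sum.inr, by rwa [Sum.elim_comp_inl_inr]⟩) (fun t ht => ht)
  refine ⟨_, hf, fun t ht => ⟨⟨f ⟨t, ht⟩, ⟨ht, rfl⟩, ?_⟩, ?_⟩⟩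
  · rintro y ⟨_, hy⟩
    exact hy.symm
  · rintro y ⟨_, hy⟩
    have := hfX ⟨t, ht⟩
    change f ⟨t, ht⟩ = y at hy
    rwa [hy] at this

/-- The parameters `p` of the family count as extra index variables; a selector for the enlarged
family is then restricted to the index value `p`. -/
theorem hasDefinableSkolemFunctions_of_hasSelectorsOver_univ
    (h : HasSelectorsOver L (univ : Set K)) : HasDefinableSkolemFunctions L K := by
  intro n k T X hT hX hne
  obtain ⟨m, p, -, φ, hφ⟩ := definable_iff_exists_tuple.1 hX
  obtain ⟨Ψ, hΨ, hsel⟩ := h.exists_selector (φ.relabel (Equiv.sumAssoc _ _ _).symm)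
  have hassoc : ∀ (t : Fin n → K) (y : Fin k → K),
      Sum.elim (Sum.elim p t) y ∘ (Equiv.sumAssoc (Fin m) (Fin n) (Fin k)).symm =
        Sum.elim p (Sum.elim t y) := by
    intro t y
    funext x
    rcases x with x | x | x <;> rfl
  have hmem : ∀ (t : Fin n → K) (y : Fin k → K),
      φ.Realize (Sum.elim p (Sum.elim t y)) ↔ t ∈ T ∧ y ∈ X t := fun t y => by
    simpa using (Set.ext_iff.1 hφ (Sum.elim t y)).symm
  have hselT : ∀ t ∈ T, (∃! y : Fin k → K, Sum.elim (Sum.elim p t) y ∈ Ψ) ∧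
      ∀ y, Sum.elim (Sum.elim p t) y ∈ Ψ → y ∈ X t := by
    intro t ht
    obtain ⟨x, hx⟩ := hne t ht
    obtain ⟨h₁, h₂⟩ := hsel (Sum.elim p t) ⟨x, by
      rw [Formula.realize_relabel, hassoc, hmem]
      exact ⟨ht, hx⟩⟩
    refine ⟨h₁, fun y hy => ?_⟩
    have := h₂ y hy
    rw [mem_ofPred_eq, Formula.realize_relabel, hassoc, hmem] at this
    exact this.2
  choose f hf hf' using fun t : T => (hselT t t.2).1
  refine ⟨f, ?_, fun t => (hselT t t.2).2 _ (hf t)⟩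
  -- Freezing the extra index variables at `p` adds `p` to the parameters `q` of the selector.
  obtain ⟨Ψ', hΨ', hΨΨ'⟩ : ∃ Ψ' : Set (Fin n ⊕ Fin k → K), (univ : Set K).Definable L Ψ' ∧
      ∀ t y, Sum.elim t y ∈ Ψ' ↔ Sum.elim (Sum.elim p t) y ∈ Ψ := by
    obtain ⟨l, q, hq, ψ, rfl⟩ := definable_iff_exists_tuple.1 hΨ
    refine ⟨_, definable_iff_exists_tuple.2 ⟨l + m, Sum.elim q p ∘ finSumFinEquiv.symm,
      fun _ => mem_univ _, ψ.relabel (Sum.elim (Sum.inl ∘ finSumFinEquiv ∘ Sum.inl)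
        (Sum.elim (Sum.elim (Sum.inl ∘ finSumFinEquiv ∘ Sum.inr) (Sum.inr ∘ Sum.inl))
          (Sum.inr ∘ Sum.inr))), rfl⟩, fun t y => ?_⟩
    simp only [mem_ofPred_eq, Formula.realize_relabel]
    refine iff_of_eq (congrArg _ (funext ?_))
    rintro (a | (a | a) | a) <;> simp
  convert (hT.preimage_comp Sum.inl).inter hΨ' using 1
  ext v
  obtain ⟨t, y, rfl⟩ : ∃ t y, v = Sum.elim t y :=
    ⟨v ∘ Sum.inl, v ∘ Sum.inr, (Sum.elim_comp_inl_inr v).symm⟩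
  simp only [mem_ofPred_eq, mem_inter_iff, mem_preimage, Sum.elim_comp_inl, Sum.elim_comp_inr,
    hΨΨ']
  constructor
  · rintro ⟨ht, hy⟩
    refine ⟨ht, ?_⟩
    rw [← hy]
    exact hf ⟨t, ht⟩
  · rintro ⟨ht, hy⟩
    exact ⟨ht, (hf' ⟨t, ht⟩ y hy).symm⟩

theorem hasDefinableSkolemFunctions_iff :
    HasDefinableSkolemFunctions L K ↔ HasSelectorsOver L (univ : Set K) :=
  ⟨hasSelectorsOver_univ_of_hasDefinableSkolemFunctions,
    hasDefinableSkolemFunctions_of_hasSelectorsOver_univ⟩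

end Selectors

/-! ### Transfer along elementary embeddings -/

section Transfer

variable {L : FirstOrder.Language.{u, v}} {K : Type w} [L.Structure K] {K' : Type w'}
  [L.Structure K'] {m n k : ℕ}

/-- The formula expressing that `ψ`, with the parameters as its first variables, defines a
section of the family defined by `φ`. -/
noncomputable def selectorFormula (φ : L.Formula (Fin n ⊕ Fin k))
    (ψ : L.Formula (Fin m ⊕ (Fin n ⊕ Fin k))) : L.Formula (Fin m) :=
  ((((φ.iExs (Fin k)).relabel Sum.inr)).imp (selectsFormula
    (φ.relabel (Sum.map Sum.inr id)) (ψ.relabel (Equiv.sumAssoc _ _ _).symm))).iAlls (Fin n)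

theorem realize_selectorFormula (φ : L.Formula (Fin n ⊕ Fin k))
    (ψ : L.Formula (Fin m ⊕ (Fin n ⊕ Fin k))) (p : Fin m → K) :
    (selectorFormula φ ψ).Realize p ↔
      ∀ t ∈ {t : Fin n → K | ∃ x : Fin k → K, φ.Realize (Sum.elim t x)},
        SelectsAt {v : Fin n ⊕ Fin k → K | φ.Realize v} {v | ψ.Realize (Sum.elim p v)} t := by
  have h₁ : ∀ (t : Fin n → K) (y : Fin k → K),
      Sum.elim (Sum.elim p t) y ∘ (Equiv.sumAssoc (Fin m) (Fin n) (Fin k)).symm =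
        Sum.elim p (Sum.elim t y) := by
    intro t y
    funext x
    rcases x with x | x | x <;> rfl
  have h₂ : ∀ (t : Fin n → K) (y : Fin k → K),
      Sum.elim (Sum.elim p t) y ∘ Sum.map Sum.inr id = Sum.elim t y := by
    intro t y
    funext x
    rcases x with x | x <;> rfl
  simp only [selectorFormula, Formula.realize_iAlls, Formula.realize_imp, Formula.realize_relabel,
    realize_selectsFormula, SelectsAt, mem_ofPred_eq, h₁, h₂, Formula.realize_iExs]
  rfl

/-- The parameters now enter only as a tuple satisfying a parameter-free formula, the form that
elementarity preserves. -/
theorem hasSelectorsOver_iff {A : Set K} :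
    HasSelectorsOver L A ↔ ∀ (n k : ℕ) (φ : L.Formula (Fin n ⊕ Fin k)),
      ∃ (m : ℕ) (ψ : L.Formula (Fin m ⊕ (Fin n ⊕ Fin k))) (p : Fin m → K),
        (∀ i, p i ∈ A) ∧ (selectorFormula φ ψ).Realize p := by
  refine forall_congr' fun n => forall_congr' fun k => forall_congr' fun φ => ?_
  constructor
  · rintro ⟨Ψ, hΨ, h⟩
    obtain ⟨m, p, hp, ψ, rfl⟩ := definable_iff_exists_tuple.1 hΨ
    exact ⟨m, ψ, p, hp, (realize_selectorFormula φ ψ p).2 h⟩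
  · rintro ⟨m, ψ, p, hp, h⟩
    exact ⟨_, definable_iff_exists_tuple.2 ⟨m, p, hp, ψ, rfl⟩, (realize_selectorFormula φ ψ p).1 h⟩

theorem HasSelectorsOver.map (h : HasSelectorsOver L (univ : Set K)) (g : K ↪ₑ[L] K') :
    HasSelectorsOver L (range g) := by
  rw [hasSelectorsOver_iff] at h ⊢
  intro n k φ
  obtain ⟨m, ψ, p, -, hp⟩ := h n k φ
  exact ⟨m, ψ, g ∘ p, fun i => mem_range_self _, (g.map_formula _ _).2 hp⟩

theorem HasSelectorsOver.comap (h : HasSelectorsOver L (univ : Set K')) (g : K ↪ₑ[L] K') :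
    HasSelectorsOver L (univ : Set K) := by
  rw [hasSelectorsOver_iff] at h ⊢
  intro n k φ
  obtain ⟨m, ψ, p, -, hp⟩ := h n k φ
  -- Quantifying the parameters away leaves a sentence, which holds in `K` as well and there gives
  -- new parameters.
  have hK' : (((selectorFormula φ ψ).relabel Sum.inr).iExs (Fin m)).Realize
      (g ∘ (Empty.elim : Empty → K)) :=
    Formula.realize_iExs.2 ⟨p, by simpa using hp⟩
  obtain ⟨q, hq⟩ := Formula.realize_iExs.1 ((g.map_formula _ _).1 hK')
  exact ⟨m, ψ, q, fun i => mem_univ _, by simpa using hq⟩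

/-- Having definable Skolem functions is invariant under elementary embeddings. -/
theorem hasDefinableSkolemFunctions_congr (g : K ↪ₑ[L] K') :
    HasDefinableSkolemFunctions L K ↔ HasDefinableSkolemFunctions L K' := by
  simp only [hasDefinableSkolemFunctions_iff]
  exact ⟨fun h => (h.map g).mono (subset_univ _), fun h => h.comap g⟩

end Transfer

/-! ### Elementarity of definable closures -/

section DefinableClosure

variable {L : FirstOrder.Language.{u, v}} {K : Type w} [L.Structure K] {A : Set K}

/-- By Tarski–Vaught it suffices to find a point of each nonempty definable set; the selector
evaluated at the parameters of the set gives one. -/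
theorem HasSelectorsOver.isElementarySubset_dcl (h : HasSelectorsOver L A) (C : Set K) :
    IsElementarySubset L (dcl L (C ∪ A)) := by
  have hA : A ⊆ dcl L (C ∪ A) := subset_union_right.trans subset_dcl
  have hmeets : L.MeetsDefinable (dcl L (C ∪ A)) := by
    rintro X ⟨a, ha⟩ hX
    obtain ⟨m, p, hp, φ, hφ⟩ := definable_iff_exists_tuple.1 hX
    obtain ⟨Ψ, hΨ, hsel⟩ := h m 1 φ
    obtain ⟨⟨y, hy, huniq⟩, hsub⟩ := hsel p
      ⟨fun _ => a, (Set.ext_iff.1 hφ fun _ => a).1 ha⟩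
    refine ⟨y 0, (Set.ext_iff.1 hφ y).2 (hsub y hy), definable_of_definable_dcl ?_⟩
    obtain ⟨l, q, hq, ψ, rfl⟩ := definable_iff_exists_tuple.1 hΨ
    refine definable_iff_exists_tuple.2 ⟨l + m, Sum.elim q p ∘ finSumFinEquiv.symm, fun i => ?_,
      ψ.relabel (Sum.elim (Sum.inl ∘ finSumFinEquiv ∘ Sum.inl)
        (Sum.elim (Sum.inl ∘ finSumFinEquiv ∘ Sum.inr) Sum.inr)), ?_⟩
    · rw [Function.comp_apply]
      rcases finSumFinEquiv.symm i with j | j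
      · exact hA (hq j)
      · exact hp j
    · ext z
      have hz : (Sum.elim (Sum.elim q p ∘ finSumFinEquiv.symm) z ∘
          Sum.elim (Sum.inl ∘ finSumFinEquiv ∘ Sum.inl)
            (Sum.elim (Sum.inl ∘ finSumFinEquiv ∘ Sum.inr) Sum.inr)) =
          Sum.elim q (Sum.elim p z) := by
        funext x
        rcases x with x | x | x <;> simp
      simp only [mem_ofPred_eq, Formula.realize_relabel, hz, mem_singleton_iff]
      constructor
      · intro hzy
        have : z = y := funext fun i => by rwa [Subsingleton.elim i 0]
        rwa [this]
      · exact fun hzy => congrFun (huniq z hzy) 0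
  exact ⟨⟨_, hmeets.isElementary_closure⟩, hmeets.closure_eq_self⟩

/-- If `K` is saturated enough and the definable closures of sets that contain `A` are elementary
substructures, then by compactness finitely many functions definable over `A` give a section of a
definable family. -/
theorem hasSelectorsOver_of_isSaturated {κ : Cardinal.{w}} (hκ : #A < κ) (hK : IsSaturated L K κ)
    (h : ∀ C : Set K, IsElementarySubset L (dcl L (C ∪ A))) : HasSelectorsOver L A := by
  intro n k φ
  set Φ : Set (Fin n ⊕ Fin k → K) := {v | φ.Realize v}
  set W : Set (Fin n → K) := {t | ∃ x : Fin k → K, φ.Realize (Sum.elim t x)}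
  have hΦ : A.Definable L Φ := definable_setOf_realize φ
  by_contra hno
  -- The type consists of the formulas off which a selector exists. If finitely many had no common
  -- solution, their complements would cover `W` and the selectors would glue, against `hno`.
  obtain ⟨t, ht⟩ := hK A hκ n {χ | HasSelectorOn L A Φ (W \ {t | χ.Realize t})} (by
    intro q hq hqfin
    by_contra! hunsat
    refine hno ((HasSelectorOn.biUnion hΦ hqfin hq).mono fun t htW => ?_)
    obtain ⟨χ, hχ, hχt⟩ := hunsat t
    exact mem_biUnion hχ ⟨htW, hχt⟩)
  have key : ∀ S : Set (Fin n → K), A.Definable L S → HasSelectorOn L A Φ (W \ S) → t ∈ S := by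
    rintro _ ⟨χ, rfl⟩ hχ
    exact ht χ hχ
  have htW : t ∈ W := key W hΦ.exists_of_finite (by
    rw [sdiff_self]
    exact hasSelectorOn_empty Φ)
  obtain ⟨x, hx, hxdcl⟩ : ∃ x : Fin k → K, φ.Realize (Sum.elim t x) ∧
      ∀ j, x j ∈ dcl L (range t ∪ A) := by
    obtain ⟨S, hS⟩ := h (range t)
    have htS : ∀ i, t i ∈ S := fun i => by
      rw [← SetLike.mem_coe, hS]
      exact subset_dcl (Or.inl (mem_range_self i))
    obtain ⟨x, hx⟩ := Formula.realize_iExs.1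
      ((S.subtype.map_formula (φ.iExs (Fin k)) fun i => ⟨t i, htS i⟩).1
        (Formula.realize_iExs.2 htW))
    refine ⟨fun j => x j, ?_, fun j => hS ▸ (x j).2⟩
    rw [← S.subtype.map_formula] at hx
    convert hx using 1
    funext i
    cases i <;> rfl
  choose Ψ hΨ hΨx using fun j => exists_definable_family_of_definable (hxdcl j)
  have hΨ' : A.Definable L (⋂ j, {v : Fin n ⊕ Fin k → K | v ∘ Sum.map id (fun _ => j) ∈ Ψ j}) :=
    definable_iInter_of_finite fun j => (hΨ j).preimage_comp _
  have hmem : ∀ y : Fin k → K,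
      Sum.elim t y ∈ (⋂ j, {v : Fin n ⊕ Fin k → K | v ∘ Sum.map id (fun _ => j) ∈ Ψ j}) ↔
        y = x := by
    intro y
    have hy : ∀ j, Sum.elim t y ∘ Sum.map id (fun _ : Fin 1 => j) =
        Sum.elim t (fun _ : Fin 1 => y j) := by
      intro j
      funext i
      cases i <;> rfl
    simp only [mem_iInter, mem_ofPred_eq, hy, hΨx, mem_singleton_iff, funext_iff]
  -- `Ψ'` is a selector wherever it succeeds, so `t` must lie where it fails; yet its fibre over `t`
  -- is exactly `x`.
  refine key _ (definable_setOf_selectsAt hΦ hΨ').compl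
    ⟨_, hΨ', fun s hs => not_not.1 hs.2⟩ ⟨⟨x, (hmem x).2 rfl, fun y hy => (hmem y).1 hy⟩, ?_⟩
  intro y hy
  rw [(hmem y).1 hy]
  exact hx

/-- Definable Skolem functions of `K` can be taken with parameters in an elementary
substructure. -/
theorem HasDefinableSkolemFunctions.hasSelectorsOver_range
    (h : HasDefinableSkolemFunctions L K) {P : Type w'} [L.Structure P] (g : P ↪ₑ[L] K) :
    HasSelectorsOver L (range g) :=
  ((hasDefinableSkolemFunctions_iff.1 h).comap g).map g

theorem hasDefinableSkolemFunctions_iff_of_isSufficientlySaturated {P : Type w'} [L.Structure P]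
    (g : P ↪ₑ[L] K) (hK : IsSufficientlySaturated L (range g)) :
    HasDefinableSkolemFunctions L K ↔
      ∀ C : Set K, IsElementarySubset L (dcl L (C ∪ range g)) := by
  obtain ⟨κ, hκ, hsat⟩ := hK
  exact ⟨fun h => (h.hasSelectorsOver_range g).isElementarySubset_dcl, fun h =>
    hasDefinableSkolemFunctions_iff.2
      ((hasSelectorsOver_of_isSaturated hκ hsat h).mono (subset_univ _))⟩

end DefinableClosure

end OMin

theorem mainTheorem6 {L : FirstOrder.Language.{u, v}} [L.IsOrdered] {M : Type w} [LinearOrder M]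
    [L.Structure M] [L.OrderedStructure M] (hM : OMin.IsOMinimal L M)
    (P : L.ElementarySubstructure M) (hP : OMin.IsPrimeModel L P) :
    (OMin.HasDefinableSkolemFunctions L M →
      ∀ C : Set M, OMin.IsElementarySubset L (OMin.dcl L (C ∪ (P : Set M)))) ∧
    (OMin.IsSufficientlySaturated L (P : Set M) →
      (OMin.HasDefinableSkolemFunctions L M ↔
        ∀ C : Set M, OMin.IsElementarySubset L (OMin.dcl L (C ∪ (P : Set M))))) ∧
    (∀ (N : Type w') [L.Structure N] (f : M ↪ₑ[L] N),
      OMin.IsSufficientlySaturated L (f '' (P : Set M)) →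
      (OMin.HasDefinableSkolemFunctions L M ↔
        ∀ C : Set N, OMin.IsElementarySubset L (OMin.dcl L (C ∪ f '' (P : Set M))))) := by
  have hrange : (P : Set M) = Set.range P.subtype := by simp
  refine ⟨fun h => ?_, fun hsat => ?_, fun N _ f hsat => ?_⟩
  · rw [hrange]
    exact (h.hasSelectorsOver_range P.subtype).isElementarySubset_dcl
  · rw [hrange] at hsat ⊢
    exact OMin.hasDefinableSkolemFunctions_iff_of_isSufficientlySaturated P.subtype hsat
  · have hcomp : f '' (P : Set M) = Set.range (f.comp P.subtype) := by
      rw [hrange, ← Set.range_comp]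
      rfl
    rw [hcomp] at hsat ⊢
    rw [OMin.hasDefinableSkolemFunctions_congr f]
    exact OMin.hasDefinableSkolemFunctions_iff_of_isSufficientlySaturated _ hsat
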